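/- A cardinal $\lambda>\omega_0$ is called $\omega_1$-strongly compact if on every set $S$ every (proper) $\lambda$-complete filter (one closed under intersections of fewer than $\lambda$ of its members) extends to an $\omega_1$-complete ultrafilter on $S$. For a uniform space $(X,\mu)$ let $wU_\mu(X)$ be the weak uniformity on $X$ induced by all real-valued uniformly continuous functions on $(X,\mu)$, and let the Samuel realcompactification $H(U_\mu(X))$ be the topological space underlying the (Hausdorff) completion of $(X,wU_\mu(X))$; a function $g:X\to\mathbb R$ extends continuously to $H(U_\mu(X))$ if there is a continuous $G:H(U_\mu(X))\to\mathbb R$ whose composition with the canonical map $X\to H(U_\mu(X))$ is $g$. Say that $(X,\mu)$ has property (R) if for every uniformly continuous $f:X\to\mathbb R$ with $f(x)\neq 0$ for all $x\in X$, the function $1/f$ extends continuously to $H(U_\mu(X))$. Theorem. Let $D$ be a set whose cardinality is $\omega_1$-strongly compact, regarded as a uniformly discrete space, let $\kappa\ge\omega_0$ be a cardinal, and let $\pi$ be the product uniformity on the Baire space $D^\kappa$. Then there is a uniformly continuous function $f:(D^\kappa,\pi)\to\mathbb R$, with $f(x)\ne 0$ for all $x\in D^\kappa$, such that $1/f$ does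 not extend continuously to $H(U_\pi(D^\kappa))$. Consequently, the uniformly discrete space $D$ has property (R) while its power $(D^\kappa,\pi)$ does not; in particular, property (R) is not preserved by products of $\kappa$ many uniform spaces. -/

import Mathlib

open scoped Cardinal

universe u v

/-- A cardinal `κ > ℵ₀` is `ω₁`-strongly compact if every (proper) `κ`-complete filter on any set
extends to an `ω₁`-complete ultrafilter. A filter is `κ`-complete if it is closed under
intersections of fewer than `κ` of its members. -/
def IsOmegaOneStronglyCompact (κ : Cardinal.{u}) : Prop :=
  ℵ₀ < κ ∧ ∀ (S : Type u) (F : Filter S), F.NeBot → CardinalInterFilter F κ →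
    ∃ U : Ultrafilter S, (U : Filter S) ≤ F ∧ CardinalInterFilter (U : Filter S) ℵ₁

/-- The weak uniformity on `X` induced by all real-valued uniformly continuous functions: the
coarsest uniformity making all of them uniformly continuous. -/
abbrev weakUniformity (X : Type u) [UniformSpace X] : UniformSpace X :=
  ⨅ f : {f : X → ℝ // UniformContinuous f}, UniformSpace.comap f.1 inferInstance

/-- A copy of the set `X`, carrying the weak uniformity instead of the given one. -/
def WithWeakUniformity (X : Type u) [UniformSpace X] : Type u := X

instance (X : Type u) [UniformSpace X] : UniformSpace (WithWeakUniformity X) :=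
  weakUniformity X

/-- The Samuel realcompactification of `X`: the (Hausdorff) completion of `X` with the weak
uniformity. -/
abbrev SamuelRealcompactification (X : Type u) [UniformSpace X] : Type u :=
  UniformSpace.Completion (WithWeakUniformity X)

/-- The canonical map of `X` into its Samuel realcompactification. -/
def toSamuel {X : Type u} [UniformSpace X] (x : X) : SamuelRealcompactification X :=
  UniformSpace.Completion.coe' (show WithWeakUniformity X from x)

/-- The function `g : X → ℝ` extends continuously to the Samuel realcompactification of `X`. -/
def ExtendsToSamuel {X : Type u} [UniformSpace X] (g : X → ℝ) : Prop :=
  ∃ G : SamuelRealcompactification X → ℝ, Continuous G ∧ ∀ x : X, G (toSamuel x) = g x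

/-- The reciprocal of every non-vanishing real-valued uniformly continuous function on `X` extends
continuously to the Samuel realcompactification of `X`. -/
def ReciprocalsExtend (X : Type u) [UniformSpace X] : Prop :=
  ∀ f : X → ℝ, UniformContinuous f → (∀ x, f x ≠ 0) → ExtendsToSamuel (fun x => 1 / f x)

open Filter Topology Uniformity

/-! Well-order `D` and let `U` be a nonprincipal `ω₁`-complete ultrafilter on it. Embed `ℕ` in `I`
and let `f x = 1 / (N + 1)`, with `N` the first place where the sequence of chosen coordinates stops
descending. Well-foundedness makes `N` finite, and finitely many coordinates determine `f` up to
`ε`. Draw coordinates successively from `U`, the last one first (`towerFilter`): they descend, so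
`f` tends to `0` along the limit filter. By `ω₁`-completeness every real function is almost constant
at each finite stage, so uniformly continuous ones are Cauchy in the limit. The filter thus
converges in the completion, where an extension of `1 / f` would force `1 = f * (1 / f)` to tend to
`0`. -/

/-- On a set whose cardinality is `ω₁`-strongly compact there is a nonprincipal `ω₁`-complete
ultrafilter. -/
theorem IsOmegaOneStronglyCompact.exists_nonprincipal {D : Type u}
    (hD : IsOmegaOneStronglyCompact (Cardinal.mk D)) :
    ∃ U : Ultrafilter D, CountableInterFilter (U : Filter D) ∧ ∀ d, {d} ∉ U := by
  obtain ⟨hω, hext⟩ := hD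
  have hreg : (Order.succ (Cardinal.mk D)).IsRegular := Cardinal.isRegular_succ hω.le
  let S : Type u := (Order.succ (Cardinal.mk D)).ord.ToType
  have hS : Cardinal.mk S = Order.succ (Cardinal.mk D) := Cardinal.mk_ord_toType _
  have hIic : ∀ a : S, Cardinal.mk (Set.Iic a) < Order.succ (Cardinal.mk D) := fun a =>
    (Cardinal.mk_Iic_lt a (by rw [hS, Ordinal.type_toType])
      (hS.symm ▸ hω.le.trans (Order.le_succ _))).trans_eq hS
  have hne : (cocardinal S hreg).NeBot := by
    rw [neBot_iff, Ne, ← empty_mem_iff_bot, mem_cocardinal, Set.compl_empty, Cardinal.mk_univ, hS]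
    exact lt_irrefl _
  obtain ⟨W, hW, hWc⟩ := hext S (cocardinal S hreg) hne
    (CardinalInterFilter.of_cardinalInterFilter_of_le _ (Order.le_succ _))
  have hWcount : CountableInterFilter (W : Filter S) := cardinalInterFilter_aleph_one_iff.1 hWc
  have hinj : ∀ x : S, ∃ j : S → D, Set.InjOn j (Set.Iic x) := fun x => by
    obtain ⟨j⟩ := Cardinal.le_def _ _ |>.1 (Order.lt_succ_iff.1 (hIic x))
    have : Nonempty D := Cardinal.mk_ne_zero_iff.1 (Cardinal.aleph0_pos.trans hω).ne'
    refine ⟨fun y => if h : y ∈ Set.Iic x then j ⟨y, h⟩ else Classical.arbitrary D, ?_⟩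
    intro y hy z hz h
    simp only [dif_pos hy, dif_pos hz] at h
    exact congrArg Subtype.val (j.injective h)
  choose j hj using hinj
  -- If all such ultrafilters were principal, pushing `W` forward along `x ↦ j x a` would pick a
  -- value `d a`. As `W` contains all final segments, `d` would inject `S` into the smaller set `D`.
  by_contra! hcon
  have hval : ∀ a : S, ∃ d : D, ∀ᶠ x in (W : Filter S), j x a = d := fun a => by
    have hc : CountableInterFilter ((W.map fun x => j x a : Ultrafilter D) : Filter D) :=
      inferInstanceAs (CountableInterFilter (Filter.map _ (W : Filter S)))
    obtain ⟨d, hd⟩ := hcon _ hc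
    exact ⟨d, hd⟩
  choose d hd using hval
  have hd_inj : Function.Injective d := fun a b hab => by
    have hab' : ∀ a : S, ∀ᶠ x in (W : Filter S), a ≤ x := fun a => by
      refine hW ?_
      rw [mem_cocardinal]
      refine (Cardinal.mk_le_mk_of_subset ?_).trans_lt (hIic a)
      intro x hx
      exact (not_le.1 (Set.notMem_ofPred_iff.1 hx)).le
    obtain ⟨x, h1, h2, h3, h4⟩ :=
      ((hd a).and ((hd b).and ((hab' a).and (hab' b)))).exists
    exact hj x h3 h4 (h1.trans (hab.trans h2.symm))
  have := Cardinal.mk_le_of_injective hd_inj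
  rw [hS] at this
  exact (Order.lt_succ (Cardinal.mk D)).not_ge this

/-- Real functions are almost constant along an `ω₁`-complete ultrafilter. -/
theorem Ultrafilter.exists_eventually_eq_real {D : Type*} (U : Ultrafilter D)
    [CountableInterFilter (U : Filter D)] (h : D → ℝ) : ∃ c, ∀ᶠ d in (U : Filter D), h d = c :=
  exists_eventuallyEq_const_of_forall_separating (f := h) MeasurableSet fun s _ =>
    U.em fun d => h d ∈ s

/-- A nonprincipal ultrafilter on a well-ordered set is almost everywhere increasing. -/
theorem Ultrafilter.eventually_eventually_lt {D : Type*} [LinearOrder D] [WellFoundedLT D]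
    (U : Ultrafilter D) (hU : ∀ d, {d} ∉ U) :
    ∀ᶠ x in (U : Filter D), ∀ᶠ y in (U : Filter D), x < y := by
  have key : ∀ᶠ x in (U : Filter D), Set.Iic x ∉ U := by
    by_contra hcon
    rw [← Ultrafilter.eventually_not] at hcon
    simp only [not_not] at hcon
    obtain ⟨a, ha, hmin⟩ := wellFounded_lt.has_min {x | Set.Iic x ∈ U} hcon.exists
    have ha' : ∀ᶠ x in (U : Filter D), x ≠ a := Ultrafilter.compl_mem_iff_notMem.2 (hU a)
    obtain ⟨x, hx, hxa, hxU⟩ := (Filter.Eventually.and ha (ha'.and hcon)).exists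
    exact hmin x hxU (lt_of_le_of_ne hx hxa)
  filter_upwards [key] with x hx
  filter_upwards [Ultrafilter.compl_mem_iff_notMem.2 hx] with y hy
  exact not_le.1 hy

/-! ### Finite iterations of a filter along coordinates -/

section Tower

variable {D : Type*} {I : Type*}

open Classical in
/-- The filters on `I → D` saying that for `U`-almost all `xₙ₋₁`, ..., for `U`-almost all `x₀` the
point with coordinates `x₀, ..., xₙ₋₁` at `e 0, ..., e (n - 1)` (and `d₀` elsewhere) belongs to a
set. -/
noncomputable def towerFilter (U : Filter D) (e : ℕ → I) (d₀ : D) : ℕ → Filter (I → D)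
  | 0 => pure fun _ => d₀
  | n + 1 => U.bind fun d => (towerFilter U e d₀ n).map fun x => Function.update x (e n) d

variable {U : Filter D} {e : ℕ → I} {d₀ : D}

open Classical in
theorem eventually_towerFilter_succ {n : ℕ} {p : (I → D) → Prop} :
    (∀ᶠ x in towerFilter U e d₀ (n + 1), p x) ↔
      ∀ᶠ d in U, ∀ᶠ x in towerFilter U e d₀ n, p (Function.update x (e n) d) := Iff.rfl

theorem towerFilter_neBot [U.NeBot] (n : ℕ) : (towerFilter U e d₀ n).NeBot := by
  induction n with
  | zero => exact pure_neBot
  | succ n ih =>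
    refine ⟨fun h => ?_⟩
    have h' : ∀ᶠ _ in towerFilter U e d₀ (n + 1), False := by rw [h]; exact eventually_bot
    rw [eventually_towerFilter_succ] at h'
    obtain ⟨_, hd⟩ := h'.exists
    exact hd.exists.elim fun _ => id

theorem bind_towerFilter_neBot [U.NeBot] : (bind atTop (towerFilter U e d₀)).NeBot := by
  refine ⟨fun h => ?_⟩
  have h' : ∀ᶠ _ in bind atTop (towerFilter U e d₀), False := by rw [h]; exact eventually_bot
  obtain ⟨n, hn⟩ := (eventually_bind.1 h').exists
  have := towerFilter_neBot (U := U) (e := e) (d₀ := d₀) n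
  exact hn.exists.elim fun _ => id

theorem exists_eventually_eq_towerFilter (hU : ∀ h : D → ℝ, ∃ c, ∀ᶠ d in U, h d = c) (n : ℕ)
    (g : (I → D) → ℝ) : ∃ c, ∀ᶠ x in towerFilter U e d₀ n, g x = c := by
  classical
  induction n generalizing g with
  | zero => exact ⟨_, eventually_pure.2 rfl⟩
  | succ n ih =>
    choose h hh using fun d => ih fun x => g (Function.update x (e n) d)
    obtain ⟨c, hc⟩ := hU h
    refine ⟨c, eventually_towerFilter_succ.2 ?_⟩
    filter_upwards [hc] with d hd
    filter_upwards [hh d] with x hx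
    exact hx.trans hd

/-- The stages after `m` only overwrite coordinates outside `s`. -/
theorem eventually_towerFilter_of_dependsOn {s : Set I} {p : (I → D) → Prop}
    (hp : DependsOn p s) {m n : ℕ} (hmn : m ≤ n) (hs : ∀ k, m ≤ k → e k ∉ s)
    (h : ∀ᶠ x in towerFilter U e d₀ m, p x) : ∀ᶠ x in towerFilter U e d₀ n, p x := by
  classical
  induction n, hmn using Nat.le_induction with
  | base => exact h
  | succ n hn ih =>
    refine eventually_towerFilter_succ.2 (Eventually.of_forall fun d => ih.mono fun x hx => ?_)
    refine (hp fun i hi => ?_).mp hx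
    rw [Function.update_of_ne]
    rintro rfl
    exact hs n hn hi

theorem eventually_towerFilter_forall_mem (he : e.Injective) {A : Set D} (hA : A ∈ U) (n : ℕ) :
    ∀ᶠ x in towerFilter U e d₀ n, ∀ i < n, x (e i) ∈ A := by
  classical
  induction n with
  | zero => exact Eventually.of_forall fun x i hi => absurd hi (Nat.not_lt_zero i)
  | succ n ih =>
    refine eventually_towerFilter_succ.2 (mem_of_superset hA fun d hd => ih.mono fun x hx i hi => ?_)
    rcases Nat.lt_succ_iff_lt_or_eq.1 hi with h | rfl
    · rw [Function.update_of_ne (he.ne h.ne)]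
      exact hx i h
    · rwa [Function.update_self]

theorem eventually_towerFilter_decreasing (he : e.Injective) {r : D → D → Prop}
    (hr : ∀ᶠ x in U, ∀ᶠ y in U, r x y) (n : ℕ) :
    ∀ᶠ x in towerFilter U e d₀ n, ∀ i, i + 1 < n → r (x (e (i + 1))) (x (e i)) := by
  classical
  induction n with
  | zero => exact Eventually.of_forall fun x i hi => absurd hi (Nat.not_lt_zero _)
  | succ n ih =>
    refine eventually_towerFilter_succ.2 (hr.mono fun d hd => ?_)
    -- With `d` fixed first, all remaining coordinates can be drawn from `{y | r d y}`.
    filter_upwards [ih, eventually_towerFilter_forall_mem he hd n] with x h1 h2 i hi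
    rw [Function.update_of_ne (he.ne (by omega : i ≠ n))]
    rcases Nat.lt_succ_iff_lt_or_eq.1 hi with h | h
    · rw [Function.update_of_ne (he.ne h.ne)]
      exact h1 i h
    · rw [h, Function.update_self]
      exact h2 i (by omega)

end Tower

/-! ### Cauchyness along the limit of the tower -/

section Pi

variable {D : Type*} {I : Type*} [UniformSpace D] [DiscreteUniformity D]

theorem hasBasis_uniformity_pi_of_discreteUniformity :
    (𝓤 (I → D)).HasBasis Set.Finite fun s => {p | ∀ i ∈ s, p.1 i = p.2 i} := by
  have h : 𝓤 (I → D) = ⨅ i, 𝓟 {p : (I → D) × (I → D) | p.1 i = p.2 i} := by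
    simp only [Pi.uniformity, DiscreteUniformity.eq_principal_setRelId, comap_principal]
    rfl
  rw [h]
  refine (hasBasis_iInf_principal_finite _).congr (fun _ => Iff.rfl) fun s _ => ?_
  ext p
  simp

/-- Along the limit of the tower every uniformly continuous real function is Cauchy. -/
theorem cauchy_map_bind_towerFilter {U : Filter D} [U.NeBot] {e : ℕ → I} (d₀ : D)
    (he : e.Injective) (hU : ∀ h : D → ℝ, ∃ c, ∀ᶠ d in U, h d = c) {g : (I → D) → ℝ}
    (hg : UniformContinuous g) :
    Cauchy (map g (bind atTop (towerFilter U e d₀))) := by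
  have := bind_towerFilter_neBot (U := U) (e := e) (d₀ := d₀)
  refine Metric.cauchy_iff.2 ⟨inferInstance, fun ε hε => ?_⟩
  obtain ⟨s, hs, hsε⟩ := hasBasis_uniformity_pi_of_discreteUniformity.eventually_iff.1
    (hg (Metric.dist_mem_uniformity (half_pos hε)))
  obtain ⟨m, hm⟩ : ∃ m, ∀ k, m ≤ k → e k ∉ s := by
    obtain ⟨m, hm⟩ := (hs.preimage he.injOn).bddAbove
    exact ⟨m + 1, fun k hk hks => absurd (hm hks) (by omega)⟩
  obtain ⟨c, hc⟩ := exists_eventually_eq_towerFilter (e := e) (d₀ := d₀) hU m g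
  -- Unlike `g x = c`, agreeing on `s` with a point where `g` equals `c` depends only on `s`, so it
  -- passes from stage `m` to all later stages.
  have hdep : DependsOn (fun x : I → D => ∃ y, (∀ i ∈ s, x i = y i) ∧ g y = c) s := by
    intro x x' hx
    refine propext (exists_congr fun y => and_congr_left fun _ => forall₂_congr fun i hi => ?_)
    rw [hx i hi]
  refine ⟨Metric.ball c (ε / 2), ?_, fun a ha b hb => ?_⟩
  · refine mem_map.2 (eventually_bind.2 ((eventually_ge_atTop m).mono fun n hn => ?_))
    refine (eventually_towerFilter_of_dependsOn hdep hn hm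
      (hc.mono fun x hx => ⟨x, fun _ _ => rfl, hx⟩)).mono ?_
    rintro x ⟨y, hxy, rfl⟩
    exact hsε (x := (x, y)) hxy
  · linarith [dist_triangle_right a b c, Metric.mem_ball.1 ha, Metric.mem_ball.1 hb]

end Pi

/-! ### The function measuring the length of descent -/

section Descent

variable {D : Type*} {I : Type*} [LinearOrder D] [WellFoundedLT D]

theorem exists_not_succ_lt (z : ℕ → D) : ∃ n, ¬ z (n + 1) < z n :=
  WellFounded.not_rel_apply_succ (r := (· < ·)) z

/-- The reciprocal of (one plus) the first place at which the sequence `z` fails to decrease. -/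
noncomputable def recipDescent (z : ℕ → D) : ℝ :=
  1 / ((Nat.find (exists_not_succ_lt z) : ℝ) + 1)

theorem recipDescent_pos (z : ℕ → D) : 0 < recipDescent z := Nat.one_div_pos_of_nat

theorem recipDescent_le {z : ℕ → D} {k : ℕ} (h : ∀ i < k, z (i + 1) < z i) :
    recipDescent z ≤ 1 / ((k : ℝ) + 1) :=
  Nat.one_div_le_one_div ((Nat.le_find_iff _ _).2 fun i hi => not_not.2 (h i hi))

/-- Either both sequences descend for `k` steps and both values lie in `(0, 1 / (k + 1)]`, or the
first failure is visible in the common coordinates and the values coincide. -/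
theorem dist_recipDescent_le {z w : ℕ → D} {k : ℕ} (h : ∀ i ≤ k, z i = w i) :
    dist (recipDescent z) (recipDescent w) ≤ 1 / ((k : ℝ) + 1) := by
  by_cases hz : ∀ i < k, z (i + 1) < z i
  · have hw : ∀ i < k, w (i + 1) < w i := fun i hi => by
      rw [← h i hi.le, ← h (i + 1) hi]
      exact hz i hi
    rw [Real.dist_eq, abs_le]
    constructor <;> linarith [recipDescent_le hz, recipDescent_le hw, recipDescent_pos z,
      recipDescent_pos w]
  · push Not at hz
    obtain ⟨i, hik, hi⟩ := hz
    have hiff : ∀ j ≤ i, (¬ z (j + 1) < z j ↔ ¬ w (j + 1) < w j) := fun j hj => by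
      rw [h j (by omega), h (j + 1) (by omega)]
    have heq : Nat.find (exists_not_succ_lt z) = Nat.find (exists_not_succ_lt w) := by
      have hz := Nat.find_min' (exists_not_succ_lt z) (not_lt.2 hi)
      refine ((Nat.find_eq_iff _).2 ⟨?_, fun j hj => ?_⟩).symm
      · exact (hiff _ hz).1 (Nat.find_spec (exists_not_succ_lt z))
      · exact fun hw => Nat.find_min _ hj ((hiff j (hj.le.trans hz)).2 hw)
    rw [recipDescent, recipDescent, heq, dist_self]
    exact Nat.one_div_pos_of_nat.le

theorem uniformContinuous_recipDescent_comp [UniformSpace D] [DiscreteUniformity D] (e : ℕ → I) :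
    UniformContinuous fun x : I → D => recipDescent fun n => x (e n) := by
  refine Metric.uniformity_basis_dist.tendsto_right_iff.2 fun ε hε => ?_
  obtain ⟨k, hk⟩ := exists_nat_one_div_lt hε
  refine hasBasis_uniformity_pi_of_discreteUniformity.eventually_iff.2
    ⟨e '' Set.Iic k, (Set.finite_Iic k).image e, fun p hp => ?_⟩
  exact (dist_recipDescent_le fun i hi => hp _ (Set.mem_image_of_mem e hi)).trans_lt hk

theorem tendsto_recipDescent_bind_towerFilter {U : Filter D} {e : ℕ → I} (d₀ : D)
    (he : e.Injective) (hU : ∀ᶠ x in U, ∀ᶠ y in U, x < y) :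
    Tendsto (fun x : I → D => recipDescent fun n => x (e n))
      (bind atTop (towerFilter U e d₀)) (𝓝 0) := by
  refine Metric.nhds_basis_ball.tendsto_right_iff.2 fun ε hε => ?_
  obtain ⟨k, hk⟩ := exists_nat_one_div_lt hε
  refine eventually_bind.2 ((eventually_gt_atTop k).mono fun n hn => ?_)
  refine (eventually_towerFilter_decreasing he hU n).mono fun x hx => ?_
  rw [Metric.mem_ball, Real.dist_eq, sub_zero, abs_of_pos (recipDescent_pos _)]
  exact (recipDescent_le fun i hi => hx i (by omega)).trans_lt hk

end Descent

/-! ### Extension to the Samuel realcompactification -/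

section Samuel

variable {X : Type*} [UniformSpace X]

theorem extendsToSamuel_of_uniformContinuous {g : X → ℝ} (hg : UniformContinuous g) :
    ExtendsToSamuel g := by
  have hg' : UniformContinuous (α := WithWeakUniformity X) g :=
    (uniformContinuous_iInf_dom (i := (⟨g, hg⟩ : {f : X → ℝ // UniformContinuous f}))
      uniformContinuous_comap)
  exact ⟨UniformSpace.Completion.extension g, UniformSpace.Completion.continuous_extension,
    fun x => UniformSpace.Completion.extension_coe hg' _⟩

/-- If `f` tends to `0` along a filter along which all uniformly continuous real functions are
Cauchy, then `1 / f` does not extend to the Samuel realcompactification. -/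
theorem not_extendsToSamuel_one_div {f : X → ℝ} (hf : ∀ x, f x ≠ 0) {L : Filter X} [L.NeBot]
    (hL : ∀ g : X → ℝ, UniformContinuous g → Cauchy (map g L)) (hf0 : Tendsto f L (𝓝 0)) :
    ¬ ExtendsToSamuel (fun x => 1 / f x) := by
  rintro ⟨G, hG, hGf⟩
  have hc : Cauchy (α := WithWeakUniformity X) L :=
    (cauchy_iInf_uniformSpace' (l := L)).2 fun g => cauchy_comap_uniformSpace.2 (hL g.1 g.2)
  obtain ⟨ξ, hξ⟩ := CompleteSpace.complete
    (hc.map (UniformSpace.Completion.uniformContinuous_coe (WithWeakUniformity X)))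
  have h1 : Tendsto (fun x : X => f x * G (toSamuel x)) L (𝓝 (0 * G ξ)) :=
    hf0.mul ((hG.tendsto ξ).comp hξ)
  have h2 : (fun x : X => f x * G (toSamuel x)) = fun _ => 1 := by
    funext x
    rw [hGf, mul_one_div_cancel (hf x)]
  rw [h2, zero_mul] at h1
  exact one_ne_zero (tendsto_nhds_unique tendsto_const_nhds h1)

theorem reciprocalsExtend_of_discreteUniformity [DiscreteUniformity X] : ReciprocalsExtend X :=
  fun _ _ _ => extendsToSamuel_of_uniformContinuous (DiscreteUniformity.uniformContinuous X _)

end Samuel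

theorem mainTheorem1 (D : Type u) [UniformSpace D] [DiscreteUniformity D]
    (hD : IsOmegaOneStronglyCompact (Cardinal.mk D)) (I : Type v) [Infinite I] :
    (∃ f : (I → D) → ℝ, UniformContinuous f ∧ (∀ x, f x ≠ 0) ∧
      ¬ ExtendsToSamuel (fun x => 1 / f x)) ∧
    (ReciprocalsExtend D ∧ ¬ ReciprocalsExtend (I → D)) ∧
    ¬ (∀ (X : I → Type u) [∀ i, UniformSpace (X i)],
      (∀ i, ReciprocalsExtend (X i)) → ReciprocalsExtend (∀ i, X i)) := by
  have key : ∃ f : (I → D) → ℝ, UniformContinuous f ∧ (∀ x, f x ≠ 0) ∧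
      ¬ ExtendsToSamuel (fun x => 1 / f x) := by
    obtain ⟨U, hUc, hU⟩ := hD.exists_nonprincipal
    obtain ⟨d₀⟩ := (U : Filter D).nonempty_of_neBot
    classical
    let := linearOrderOfSTO (WellOrderingRel (α := D))
    have : WellFoundedLT D := inferInstanceAs (IsWellFounded D WellOrderingRel)
    have he := (Infinite.natEmbedding I).injective
    have := bind_towerFilter_neBot (U := (U : Filter D)) (e := Infinite.natEmbedding I) (d₀ := d₀)
    have hne : ∀ x : I → D, (recipDescent fun n => x (Infinite.natEmbedding I n)) ≠ 0 :=
      fun x => (recipDescent_pos _).ne'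
    exact ⟨_, uniformContinuous_recipDescent_comp (Infinite.natEmbedding I), hne,
      not_extendsToSamuel_one_div hne
        (fun g hg => cauchy_map_bind_towerFilter d₀ he U.exists_eventually_eq_real hg)
        (tendsto_recipDescent_bind_towerFilter d₀ he (U.eventually_eventually_lt hU))⟩
  have hpow : ¬ ReciprocalsExtend (I → D) := fun h => by
    obtain ⟨f, hf, hf0, hfG⟩ := key
    exact hfG (h f hf hf0)
  exact ⟨key, ⟨reciprocalsExtend_of_discreteUniformity, hpow⟩, fun h =>
    hpow (h (fun _ => D) fun _ => reciprocalsExtend_of_discreteUniformity)⟩
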